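/- Let $d\ge 2$ be an integer and let $\mathbb T_d$ be the infinite rooted tree in which every vertex has exactly $d$ children. The frog model $\mathrm{FM}(d,q,p)$ with death $1-q$ and drift $p$ is the following discrete-time process on $\mathbb T_d$. Initially there is one active frog at the root and one sleeping frog at each non-root vertex. At each time step every active frog, independently of all other frogs and of the past, dies with probability $1-q$; if it survives, it moves to the parent of its current vertex with probability $p$ (at the root it instead stays in place with probability $p$), and with probability $1-p$ it moves to a uniformly chosen child of its current vertex. Whenever an active frog visits a vertex with a sleeping frog, the sleeping frog becomes active. A realization is called recurrent if the root is visited by infinitely many distinct active frogs. **Theorem.** For every integer $d\ge 2$ and all $(p,q)\in[0.4950,0.4975]\times[0.9999998,1]$, $$\mathbf P\big(\mathrm{FM}(d,q,p)\text{ is recurrent}\big)>0.$$ -/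

import Mathlib

open MeasureTheory

/-- Vertices of the infinite rooted `d`-ary tree: the root is `[]`, the children of `x` are the
vertices `i :: x` for `i : Fin d`, and the parent of a non-root vertex `x` is `x.tail`. -/
abbrev TreeVertex (d : ℕ) : Type := List (Fin d)

/-- What an active frog is told when it is about to take a step: die, move towards the root, or
move to the `i`-th child of its current position. -/
inductive FrogStep (d : ℕ) : Type
  | die : FrogStep d
  | toward : FrogStep d
  | away (i : Fin d) : FrogStep d

instance (d : ℕ) : MeasurableSpace (FrogStep d) := ⊤

/-- The law of a single step: the frog dies with probability `1 - q`; if it survives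
(probability `q`) it moves towards the root with probability `p`, and to a uniformly chosen child
with probability `1 - p`. -/
noncomputable def frogStepLaw (d : ℕ) (q p : ℝ) : Measure (FrogStep d) :=
  ENNReal.ofReal (1 - q) • Measure.dirac FrogStep.die
    + ENNReal.ofReal (q * p) • Measure.dirac FrogStep.toward
    + ∑ i : Fin d, ENNReal.ofReal (q * ((1 - p) / d)) • Measure.dirac (FrogStep.away i)

theorem isProbabilityMeasure_frogStepLaw {d : ℕ} (hd : d ≠ 0) {q p : ℝ}
    (hq : q ∈ Set.Icc (0 : ℝ) 1) (hp : p ∈ Set.Icc (0 : ℝ) 1) :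
    IsProbabilityMeasure (frogStepLaw d q p) := by
  have hq0 := hq.1
  have hp0 := hp.1
  have h1 : 0 ≤ 1 - q := sub_nonneg.2 hq.2
  have h2 : 0 ≤ 1 - p := sub_nonneg.2 hp.2
  have hd' : (d : ℝ) ≠ 0 := Nat.cast_ne_zero.2 hd
  constructor
  simp only [frogStepLaw, Measure.coe_add, Measure.coe_finsetSum, Measure.coe_smul,
    Pi.add_apply, Finset.sum_apply, Pi.smul_apply, measure_univ, smul_eq_mul, mul_one]
  rw [← ENNReal.ofReal_sum_of_nonneg (fun _ _ => by positivity),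
    ← ENNReal.ofReal_add h1 (by positivity), ← ENNReal.ofReal_add (by positivity)
      (Finset.sum_nonneg fun _ _ => by positivity)]
  simp only [Finset.sum_const, Finset.card_univ, Fintype.card_fin, nsmul_eq_mul]
  rw [show 1 - q + q * p + d * (q * ((1 - p) / d)) = 1 by field_simp; ring, ENNReal.ofReal_one]

/-- The randomness of the model: `ω (v, k)` is the instruction that the frog which starts at the
vertex `v` uses for its `(k + 1)`-st step after being activated. -/
abbrev FrogInstructions (d : ℕ) : Type := TreeVertex d × ℕ → FrogStep d

/-- All instructions, of all frogs and for all steps, are independent with law `frogStepLaw`. -/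
noncomputable def frogMeasure (d : ℕ) (q p : ℝ) : Measure (FrogInstructions d) :=
  Measure.infinitePi fun _ : TreeVertex d × ℕ => frogStepLaw d q p

/-- The state of a frog: asleep (at its starting vertex), active at the vertex `x` having taken
`k` steps since its activation, or dead. -/
inductive FrogState (d : ℕ) : Type
  | asleep : FrogState d
  | active (x : TreeVertex d) (k : ℕ) : FrogState d
  | dead : FrogState d

/-- The frog is active and located at `x`. -/
def FrogState.IsActiveAt {d : ℕ} (s : FrogState d) (x : TreeVertex d) : Prop :=
  ∃ k : ℕ, s = FrogState.active x k

/-- A configuration gives the state of each frog; frogs are named by their starting vertices. -/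
abbrev FrogConfig (d : ℕ) : Type := TreeVertex d → FrogState d

/-- At time `0` the frog at the root is active and all other frogs are asleep. -/
def FrogConfig.initial (d : ℕ) : FrogConfig d
  | [] => FrogState.active [] 0
  | _ :: _ => FrogState.asleep

/-- The state of the frog `v` after its next step. A step towards the root from the root stays in
place, since `[].tail = []`. -/
def FrogState.move {d : ℕ} (ω : FrogInstructions d) (v : TreeVertex d) :
    FrogState d → FrogState d
  | FrogState.asleep => FrogState.asleep
  | FrogState.dead => FrogState.dead
  | FrogState.active x k =>
    match ω (v, k) with
    | FrogStep.die => FrogState.dead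
    | FrogStep.toward => FrogState.active x.tail (k + 1)
    | FrogStep.away i => FrogState.active (i :: x) (k + 1)

open Classical in
/-- One unit of time: all active frogs take a step (or die), and then each sleeping frog whose
vertex is now occupied by an active frog becomes active. -/
noncomputable def FrogConfig.next {d : ℕ} (ω : FrogInstructions d) (η : FrogConfig d) :
    FrogConfig d := fun v =>
  if η v = FrogState.asleep ∧ ∃ u, ((η u).move ω u).IsActiveAt v then FrogState.active v 0
  else (η v).move ω v

/-- The frog model: the configuration at time `n`. -/
noncomputable def frogModel {d : ℕ} (ω : FrogInstructions d) : ℕ → FrogConfig d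
  | 0 => FrogConfig.initial d
  | n + 1 => (frogModel ω n).next ω

/-- A realization is recurrent if the root is visited by infinitely many active frogs. -/
def FrogRecurrent {d : ℕ} (ω : FrogInstructions d) : Prop :=
  {v : TreeVertex d | ∃ n : ℕ, (frogModel ω n v).IsActiveAt []}.Infinite

/-!
Fix `x` and follow only the frogs which start below `x`. The frog at `x` visits a given child with
probability at least `r ≈ 0.9 / d`, a given grandchild with probability at least `r ^ 2`, and the
root with probability at least `h ^ |x|`, `h ≈ 0.9`; all three bounds come from one function which
is subharmonic for the walk of a frog. A grandchild is woken either by `x` alone or by the relay of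
`x` and the child in between, hence with probability at least `2 r² - r³`. As
`d² (2 r² - r³) h² > 1`, the expected number of frogs at depth `2n` which are woken by a chain of
`n` relays and then visit the root does not decay in `n`. Disjoint subtrees are independent, so a
second-moment inequality at each branching turns this into a lower bound, uniform in `n`, for the
probability that there is such a frog, and with positive probability there is one for infinitely
many `n`.
-/

section SecondMoment

variable {Ω ι : Type*} [MeasurableSpace Ω] [Fintype ι] {μ : Measure Ω}

theorem integrable_indicator_one [IsFiniteMeasure μ] {A : Set Ω} (hA : MeasurableSet A) :
    Integrable (A.indicator (1 : Ω → ℝ)) μ :=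
  (integrable_const (1 : ℝ)).indicator hA

theorem integral_sum_indicator_one [IsFiniteMeasure μ] {B : ι → Set Ω}
    (hB : ∀ i, MeasurableSet (B i)) :
    ∫ ω, ∑ i, (B i).indicator (1 : Ω → ℝ) ω ∂μ = ∑ i, μ.real (B i) := by
  rw [integral_finsetSum _ fun i _ => integrable_indicator_one (hB i)]
  exact Finset.sum_congr rfl fun i _ => integral_indicator_one (hB i)

/- With `X` the number of events which occur, integrate `1 - (1 - t * X) ^ 2 ≤ 1_{X ≠ 0}`; the best
choice of `t` would give the Chung–Erdős inequality. -/
theorem two_mul_sum_sub_le_measureReal_iUnion [IsFiniteMeasure μ] {B : ι → Set Ω}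
    (hB : ∀ i, MeasurableSet (B i)) (t : ℝ) :
    2 * t * ∑ i, μ.real (B i) - t ^ 2 * ∑ i, ∑ j, μ.real (B i ∩ B j) ≤ μ.real (⋃ i, B i) := by
  have hBB (ij : ι × ι) : MeasurableSet (B ij.1 ∩ B ij.2) := (hB ij.1).inter (hB ij.2)
  set X : Ω → ℝ := fun ω => ∑ i, (B i).indicator 1 ω with hX
  set Y : Ω → ℝ := fun ω => ∑ ij : ι × ι, (B ij.1 ∩ B ij.2).indicator 1 ω with hY
  have hYX (ω : Ω) : Y ω = X ω ^ 2 := by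
    simp only [hX, hY, sq, Fintype.sum_prod_type, Finset.sum_mul_sum, Set.inter_indicator_one,
      Pi.mul_apply]
  have hX_int : Integrable X μ :=
    integrable_finsetSum _ fun i _ => integrable_indicator_one (hB i)
  have hY_int : Integrable Y μ :=
    integrable_finsetSum _ fun ij _ => integrable_indicator_one (hBB ij)
  have pointwise (ω : Ω) : 2 * t * X ω - t ^ 2 * Y ω ≤ (⋃ i, B i).indicator 1 ω := by
    by_cases hω : ω ∈ ⋃ i, B i
    · rw [Set.indicator_of_mem hω, Pi.one_apply, hYX]
      linarith [sq_nonneg (1 - t * X ω)]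
    · have hX0 : X ω = 0 := Finset.sum_eq_zero fun i _ =>
        Set.indicator_of_notMem (fun h => hω (Set.mem_iUnion_of_mem i h)) _
      rw [Set.indicator_of_notMem hω, hYX, hX0]
      simp
  calc 2 * t * ∑ i, μ.real (B i) - t ^ 2 * ∑ i, ∑ j, μ.real (B i ∩ B j)
      = ∫ ω, (2 * t * X ω - t ^ 2 * Y ω) ∂μ := by
        rw [integral_sub (hX_int.const_mul _) (hY_int.const_mul _), integral_const_mul,
          integral_const_mul, integral_sum_indicator_one hB, integral_sum_indicator_one hBB,
          Fintype.sum_prod_type]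
    _ ≤ ∫ ω, (⋃ i, B i).indicator 1 ω ∂μ :=
        integral_mono ((hX_int.const_mul _).sub (hY_int.const_mul _))
          (integrable_indicator_one (.iUnion hB)) pointwise
    _ = μ.real (⋃ i, B i) := integral_indicator_one (.iUnion hB)

theorem mul_sub_sq_le_measureReal_iUnion_inter [IsFiniteMeasure μ] {E U : ι → Set Ω} {e σ : ℝ}
    (hE : ∀ i, MeasurableSet (E i)) (hU : ∀ i, MeasurableSet (U i))
    (hEU : ∀ i, μ.real (E i ∩ U i) = μ.real (E i) * μ.real (U i))
    (hUU : Pairwise fun i j => μ.real (U i ∩ U j) = μ.real (U i) * μ.real (U j))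
    (he : ∀ i, e ≤ μ.real (E i)) (hσ₀ : 0 ≤ σ) (hσ : σ ≤ ∑ i, μ.real (U i)) :
    e * σ - σ ^ 2 ≤ μ.real (⋃ i, E i ∩ U i) := by
  classical
  set S : ℝ := ∑ i, μ.real (U i) with hS
  set N : ℝ := ∑ i, μ.real (E i ∩ U i) with hN
  obtain ⟨t, ht₀, ht₁, htS⟩ : ∃ t : ℝ, 0 ≤ t ∧ t ≤ 1 ∧ t * S = σ := by
    rcases (hσ₀.trans hσ).eq_or_lt with hS₀ | hS₀
    · exact ⟨0, le_rfl, zero_le_one, by linarith⟩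
    · exact ⟨σ / S, by positivity, div_le_one_of_le₀ hσ hS₀.le, div_mul_cancel₀ σ hS₀.ne'⟩
  have hN₀ : 0 ≤ N := Finset.sum_nonneg fun _ _ => measureReal_nonneg
  have first_moment : e * S ≤ N := by
    rw [hS, hN, Finset.mul_sum]
    exact Finset.sum_le_sum fun i _ =>
      (mul_le_mul_of_nonneg_right (he i) measureReal_nonneg).trans_eq (hEU i).symm
  have pair_le (i j : ι) : μ.real ((E i ∩ U i) ∩ (E j ∩ U j)) ≤
      (if i = j then μ.real (E i ∩ U i) else 0) + μ.real (U i) * μ.real (U j) := by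
    split_ifs with hij
    · rw [hij, Set.inter_self]
      exact le_add_of_nonneg_right (by positivity)
    · rw [zero_add, ← hUU hij]
      exact measureReal_mono (Set.inter_subset_inter Set.inter_subset_right Set.inter_subset_right)
  have second_moment : ∑ i, ∑ j, μ.real ((E i ∩ U i) ∩ (E j ∩ U j)) ≤ N + S ^ 2 := by
    refine (Finset.sum_le_sum fun i _ => Finset.sum_le_sum fun j _ => pair_le i j).trans_eq ?_
    simp only [Finset.sum_add_distrib, Finset.sum_ite_eq, Finset.mem_univ, if_true, hN, hS, sq,
      Finset.sum_mul_sum]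
  calc e * σ - σ ^ 2 = t * (e * S) - t ^ 2 * S ^ 2 := by rw [← htS]; ring
    _ ≤ t * N - t ^ 2 * S ^ 2 := by gcongr
    _ ≤ 2 * t * N - t ^ 2 * (N + S ^ 2) := by
        linarith [mul_nonneg (mul_nonneg ht₀ hN₀) (sub_nonneg.2 ht₁)]
    _ ≤ 2 * t * N - t ^ 2 * ∑ i, ∑ j, μ.real ((E i ∩ U i) ∩ (E j ∩ U j)) := by gcongr
    _ ≤ μ.real (⋃ i, E i ∩ U i) :=
        two_mul_sum_sub_le_measureReal_iUnion (fun i => (hE i).inter (hU i)) t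

end SecondMoment

theorem le_measure_frequently {Ω : Type*} [MeasurableSpace Ω] {μ : Measure Ω} [IsFiniteMeasure μ]
    {A : ℕ → Set Ω} (hA : ∀ n, MeasurableSet (A n)) {c : ENNReal} (hc : ∀ n, c ≤ μ (A n)) :
    c ≤ μ {ω | ∃ᶠ n in Filter.atTop, ω ∈ A n} := by
  have frequently_eq : {ω | ∃ᶠ n in Filter.atTop, ω ∈ A n} = ⋂ N, ⋃ n ≥ N, A n := by
    ext ω
    simp [Filter.frequently_atTop]
  have tail_antitone : Antitone fun N => ⋃ n ≥ N, A n := fun M N hMN =>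
    Set.biUnion_subset_biUnion_left fun n hn => le_trans hMN hn
  have tail_measurable (N : ℕ) : MeasurableSet (⋃ n ≥ N, A n) :=
    .iUnion fun n => .iUnion fun _ => hA n
  rw [frequently_eq]
  refine ge_of_tendsto' (tendsto_measure_iInter_atTop
    (fun N => (tail_measurable N).nullMeasurableSet) tail_antitone ⟨0, measure_ne_top _ _⟩)
    fun N => (hc N).trans (measure_mono ?_)
  exact Set.subset_biUnion_of_mem (u := A) (le_refl N)

section InfinitePi

variable {ι : Type*} {X : ι → Type*} [∀ i, MeasurableSpace (X i)] {P : ∀ i, Measure (X i)}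
  [∀ i, IsProbabilityMeasure (P i)]

theorem measureReal_infinitePi_inter_of_disjoint {S T : Set ι} (hST : Disjoint S T)
    {A B : Set (∀ i, X i)} (hA : MeasurableSet[cylinderEvents S] A)
    (hB : MeasurableSet[cylinderEvents T] B) :
    (Measure.infinitePi P).real (A ∩ B) =
      (Measure.infinitePi P).real A * (Measure.infinitePi P).real B := by
  have coordinates_indep := ProbabilityTheory.iIndepFun_infinitePi (P := P) (X := fun _ t => t)
    fun _ => measurable_id
  have cylinders_indep := ProbabilityTheory.indep_iSup_of_disjoint
    (fun i => (measurable_pi_apply i).comap_le) coordinates_indep hST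
  rw [Measure.real, (ProbabilityTheory.Indep_iff _ _ _).1 cylinders_indep A B hA hB,
    ENNReal.toReal_mul]
  rfl

theorem measurableSet_cylinderEvents_eval_eq {S : Set ι} {a : ι} [MeasurableSingletonClass (X a)]
    (ha : a ∈ S) (t : X a) : MeasurableSet[cylinderEvents S] {ω : ∀ i, X i | ω a = t} :=
  measurable_cylinderEvent_apply ha (measurableSet_singleton t)

theorem measureReal_infinitePi_iUnion_eval_eq_inter {κ : Type*} [Fintype κ] {S : Set ι} {a : ι}
    [MeasurableSingletonClass (X a)] (ha : a ∉ S) {t : κ → X a} (ht : Function.Injective t)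
    {R : κ → Set (∀ i, X i)} (hR : ∀ o, MeasurableSet[cylinderEvents S] (R o)) :
    (Measure.infinitePi P).real (⋃ o, {ω | ω a = t o} ∩ R o) =
      ∑ o, (P a).real {t o} * (Measure.infinitePi P).real (R o) := by
  have eval_measurable (o : κ) := measurableSet_cylinderEvents_eval_eq (Set.mem_singleton a) (t o)
  rw [measureReal_iUnion_fintype]
  · refine Finset.sum_congr rfl fun o _ => ?_
    rw [measureReal_infinitePi_inter_of_disjoint (Set.disjoint_singleton_left.2 ha)
      (eval_measurable o) (hR o)]
    congr 1
    exact (measurePreserving_eval_infinitePi P a).measureReal_preimage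
      (measurableSet_singleton _).nullMeasurableSet
  · exact fun o o' hne => Set.disjoint_left.2 fun ω h h' => hne (ht (h.1.symm.trans h'.1))
  · exact fun o =>
      (cylinderEvents_le_pi _ (eval_measurable o)).inter (cylinderEvents_le_pi _ (hR o))

end InfinitePi

section Deterministic

variable {d : ℕ} {ω : FrogInstructions d}

namespace FrogState

theorem move_eq_asleep {v : TreeVertex d} {s : FrogState d} (h : s.move ω v = asleep) :
    s = asleep := by
  cases s with
  | asleep => rfl
  | dead => exact h
  | active x k => cases hω : ω (v, k) <;> simp [move, hω] at h

theorem ne_asleep_of_isActiveAt {s : FrogState d} {x : TreeVertex d} (h : s.IsActiveAt x) :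
    s ≠ asleep := by
  rintro rfl
  obtain ⟨k, hk⟩ := h
  cases hk

theorem isActiveAt_active_iff {x w : TreeVertex d} {k : ℕ} :
    (active x k).IsActiveAt w ↔ x = w := by
  simp [IsActiveAt]

end FrogState

theorem frogModel_succ_of_ne_asleep {n : ℕ} {v : TreeVertex d}
    (h : frogModel ω n v ≠ FrogState.asleep) :
    frogModel ω (n + 1) v = (frogModel ω n v).move ω v :=
  if_neg fun H => h H.1

theorem frogModel_add_of_ne_asleep {n : ℕ} {v : TreeVertex d}
    (h : frogModel ω n v ≠ FrogState.asleep) (m : ℕ) :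
    frogModel ω (n + m) v = (FrogState.move ω v)^[m] (frogModel ω n v) := by
  induction m generalizing n with
  | zero => rfl
  | succ m ih =>
    have h' : frogModel ω (n + 1) v ≠ FrogState.asleep := by
      rw [frogModel_succ_of_ne_asleep h]
      exact mt FrogState.move_eq_asleep h
    rw [Function.iterate_succ_apply, ← frogModel_succ_of_ne_asleep h, ← ih h', Nat.add_right_comm,
      Nat.add_assoc]

theorem frogModel_ne_asleep_of_isActiveAt {n : ℕ} {v w : TreeVertex d}
    (h : (frogModel ω n v).IsActiveAt w) : frogModel ω n w ≠ FrogState.asleep := by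
  cases n with
  | zero =>
    cases v with
    | nil =>
      obtain rfl := FrogState.isActiveAt_active_iff.1 h
      exact FrogState.ne_asleep_of_isActiveAt h
    | cons => exact absurd rfl (FrogState.ne_asleep_of_isActiveAt h)
  | succ n =>
    intro hw
    by_cases hv : frogModel ω n v = FrogState.asleep ∧
        ∃ u, ((frogModel ω n u).move ω u).IsActiveAt v
    · have hv' : frogModel ω (n + 1) v = FrogState.active v 0 := if_pos hv
      rw [hv', FrogState.isActiveAt_active_iff] at h
      rw [← h, hv'] at hw
      cases hw
    · rw [show frogModel ω (n + 1) v = (frogModel ω n v).move ω v from if_neg hv] at h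
      have hw' : frogModel ω n w = FrogState.asleep := by
        by_contra hne
        rw [frogModel_succ_of_ne_asleep hne] at hw
        exact hne (FrogState.move_eq_asleep hw)
      rw [show frogModel ω (n + 1) w = FrogState.active w 0 from if_pos ⟨hw', v, h⟩] at hw
      cases hw

namespace FrogInstructions

/-- The frog which starts at `v` is activated at some time. -/
def Activates (ω : FrogInstructions d) (v : TreeVertex d) : Prop :=
  ∃ n, frogModel ω n v = FrogState.active v 0

/-- The walk of the frog `v`, whether or not that frog is ever activated, visits `w`. -/
def Hits (ω : FrogInstructions d) (v w : TreeVertex d) : Prop :=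
  ∃ n, ((FrogState.move ω v)^[n] (FrogState.active v 0)).IsActiveAt w

theorem activates_root : ω.Activates [] := ⟨0, rfl⟩

theorem activates_of_ne_asleep {n : ℕ} {v : TreeVertex d}
    (h : frogModel ω n v ≠ FrogState.asleep) : ω.Activates v := by
  induction n with
  | zero =>
    cases v with
    | nil => exact activates_root
    | cons => exact absurd rfl h
  | succ n ih =>
    by_cases hn : frogModel ω n v = FrogState.asleep
    · by_cases hu : ∃ u, ((frogModel ω n u).move ω u).IsActiveAt v
      · exact ⟨n + 1, if_pos ⟨hn, hu⟩⟩
      · refine absurd ?_ h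
        rw [show frogModel ω (n + 1) v = (frogModel ω n v).move ω v from if_neg fun H => hu H.2, hn]
        rfl
    · exact ih hn

theorem Activates.exists_isActiveAt {v w : TreeVertex d} (hv : ω.Activates v)
    (h : ω.Hits v w) : ∃ n, (frogModel ω n v).IsActiveAt w := by
  obtain ⟨n, hn⟩ := hv
  obtain ⟨m, hm⟩ := h
  refine ⟨n + m, ?_⟩
  rwa [frogModel_add_of_ne_asleep (by simp [hn]), hn]

theorem Activates.of_hits {v w : TreeVertex d} (hv : ω.Activates v) (h : ω.Hits v w) :
    ω.Activates w :=
  let ⟨_, hn⟩ := hv.exists_isActiveAt h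
  activates_of_ne_asleep (frogModel_ne_asleep_of_isActiveAt hn)

/-- The frogs `x` and `i :: x` alone carry the activation from `x` to its grandchild
`j :: i :: x`. -/
def Relays (ω : FrogInstructions d) (x : TreeVertex d) (i j : Fin d) : Prop :=
  ω.Hits x (j :: i :: x) ∨ (ω.Hits x (i :: x) ∧ ω.Hits (i :: x) (j :: i :: x))

/-- A chain of `n` relays leads from `x` to a vertex, `2 * n` levels further down, whose frog visits
the root. -/
def RelaysBack (ω : FrogInstructions d) : ℕ → TreeVertex d → Prop
  | 0, x => ω.Hits x []
  | n + 1, x => ∃ ij : Fin d × Fin d,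
      ω.Relays x ij.1 ij.2 ∧ ω.RelaysBack n (ij.2 :: ij.1 :: x)

theorem Activates.of_relays {x : TreeVertex d} {i j : Fin d} (hx : ω.Activates x)
    (h : ω.Relays x i j) : ω.Activates (j :: i :: x) :=
  h.elim hx.of_hits fun h => (hx.of_hits h.1).of_hits h.2

theorem Activates.exists_visitor_of_relaysBack {n : ℕ} {x : TreeVertex d} (hx : ω.Activates x)
    (h : ω.RelaysBack n x) :
    ∃ v : TreeVertex d, v.length = x.length + 2 * n ∧ ∃ m, (frogModel ω m v).IsActiveAt [] := by
  induction n generalizing x with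
  | zero => exact ⟨x, rfl, hx.exists_isActiveAt h⟩
  | succ n ih =>
    obtain ⟨⟨i, j⟩, hrelay, hback⟩ := h
    obtain ⟨v, hv, hvisit⟩ := ih (hx.of_relays hrelay) hback
    refine ⟨v, ?_, hvisit⟩
    rw [hv, List.length_cons, List.length_cons]
    ring

theorem frogRecurrent_of_frequently_relaysBack
    (h : ∃ᶠ n in Filter.atTop, ω.RelaysBack n []) : FrogRecurrent ω := by
  refine Set.Infinite.of_image List.length (Set.infinite_of_forall_exists_gt fun N => ?_)
  obtain ⟨n, hn, hback⟩ := Filter.frequently_atTop.1 h (N + 1)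
  obtain ⟨v, hv, hvisit⟩ := activates_root.exists_visitor_of_relaysBack hback
  refine ⟨v.length, ⟨v, hvisit, rfl⟩, ?_⟩
  rw [hv, List.length_nil]
  lia

end FrogInstructions

end Deterministic

section Potential

variable {d : ℕ}

namespace TreeVertex

/-- The subtree rooted at `x`: `x` and all its descendants. -/
def subtree (x : TreeVertex d) : Set (TreeVertex d) := {v | x <:+ v}

theorem cons_cons_subset_subtree (x : TreeVertex d) (i j : Fin d) :
    subtree (j :: i :: x) ⊆ subtree x :=
  fun _ hv => ((List.suffix_cons i x).trans (List.suffix_cons j _)).trans hv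

theorem disjoint_subtree {x y : TreeVertex d} (hlen : x.length = y.length) (hxy : x ≠ y) :
    Disjoint (subtree x) (subtree y) :=
  Set.disjoint_left.2 fun _ hx hy =>
    hxy ((List.suffix_of_suffix_length_le hx hy hlen.le).eq_of_length hlen)

theorem exists_child_suffix {x w : TreeVertex d} (hxw : x <:+ w) (hne : x ≠ w) :
    ∃ i, (i :: x) <:+ w := by
  obtain ⟨t, rfl⟩ := hxw
  rcases t.eq_nil_or_concat with rfl | ⟨t, i, rfl⟩
  · exact absurd rfl hne
  · exact ⟨i, t, by simp⟩

end TreeVertex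

/-- The transition operator of the walk of one frog: the mean of `φ` at the position after one step
from `x`, where a frog which dies contributes `0`. -/
noncomputable def stepMean (q p : ℝ) (φ : TreeVertex d → ℝ) (x : TreeVertex d) : ℝ :=
  q * (p * φ x.tail + (1 - p) / d * ∑ i : Fin d, φ (i :: x))

theorem stepMean_mono {q₀ q p : ℝ} (hq₀ : 0 ≤ q₀) (hq : q₀ ≤ q) (hp : p ∈ Set.Icc (0 : ℝ) 1)
    {φ ψ : TreeVertex d → ℝ} (hψ : ∀ x, 0 ≤ ψ x) (h : ∀ x, φ x ≤ ψ x) (x : TreeVertex d) :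
    stepMean q₀ p φ x ≤ stepMean q p ψ x := by
  have hp₀ := hp.1
  have hp₁ := sub_nonneg.2 hp.2
  have hsum : 0 ≤ ∑ i : Fin d, ψ (i :: x) := Finset.sum_nonneg fun i _ => hψ _
  have htail := hψ x.tail
  calc stepMean q₀ p φ x ≤ stepMean q₀ p ψ x := by
        unfold stepMean
        gcongr <;> exact h _
    _ ≤ stepMean q p ψ x := mul_le_mul_of_nonneg_right hq (by positivity)

theorem stepMean_sub_const (hd : d ≠ 0) (q p c : ℝ) (φ : TreeVertex d → ℝ) (x : TreeVertex d) :
    stepMean q p (fun y => φ y - c) x = stepMean q p φ x - q * c := by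
  have hd' : (d : ℝ) ≠ 0 := Nat.cast_ne_zero.2 hd
  simp only [stepMean, Finset.sum_sub_distrib, Finset.sum_const, Finset.card_univ,
    Fintype.card_fin, nsmul_eq_mul]
  field_simp
  ring

/-- If `a` is the last common vertex of the paths from the root to `w` and to `x`, this is
`r ^ j * h ^ m` with `j` the distance from `a` to `w` and `m` the distance from `x` to `a`. It is
used as a lower bound for the probability that the walk of a frog at `x` visits `w`. -/
noncomputable def potential (r h : ℝ) (w : TreeVertex d) : TreeVertex d → ℝ
  | [] => r ^ w.length
  | i :: x => if (i :: x) <:+ w then r ^ (w.length - (x.length + 1)) else h * potential r h w x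

section

variable {r h : ℝ} {w : TreeVertex d}

theorem potential_of_suffix {x : TreeVertex d} (hx : x <:+ w) :
    potential r h w x = r ^ (w.length - x.length) := by
  cases x with
  | nil => rfl
  | cons i x => exact if_pos hx

theorem potential_cons_of_not_suffix {i : Fin d} {x : TreeVertex d} (hx : ¬ (i :: x) <:+ w) :
    potential r h w (i :: x) = h * potential r h w x :=
  if_neg hx

theorem potential_root (x : TreeVertex d) : potential r h [] x = h ^ x.length := by
  induction x with
  | nil => rfl
  | cons i x ih =>
    rw [potential_cons_of_not_suffix (by simp), ih, List.length_cons, pow_succ']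

theorem potential_child (i : Fin d) (x : TreeVertex d) : potential r h (i :: x) x = r := by
  rw [potential_of_suffix (List.suffix_cons i x), List.length_cons, Nat.add_sub_cancel_left,
    pow_one]

theorem potential_grandchild (i j : Fin d) (x : TreeVertex d) :
    potential r h (j :: i :: x) x = r ^ 2 := by
  rw [potential_of_suffix ((List.suffix_cons i x).trans (List.suffix_cons j _)), List.length_cons,
    List.length_cons, Nat.add_assoc, Nat.add_sub_cancel_left]

theorem potential_mem_Icc (hr : r ∈ Set.Icc (0 : ℝ) 1) (hh : h ∈ Set.Icc (0 : ℝ) 1)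
    (x : TreeVertex d) : potential r h w x ∈ Set.Icc (0 : ℝ) 1 := by
  induction x with
  | nil => exact ⟨pow_nonneg hr.1 _, pow_le_one₀ hr.1 hr.2⟩
  | cons i x ih =>
    by_cases hx : (i :: x) <:+ w
    · rw [potential_of_suffix hx]
      exact ⟨pow_nonneg hr.1 _, pow_le_one₀ hr.1 hr.2⟩
    · rw [potential_cons_of_not_suffix hx]
      exact ⟨mul_nonneg hh.1 ih.1, mul_le_one₀ hh.2 ih.1 ih.2⟩

theorem potential_le_stepMean_of_not_suffix {p q : ℝ} (hr : r ∈ Set.Icc (0 : ℝ) 1)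
    (hh : h ∈ Set.Icc (0 : ℝ) 1) (hup : h ≤ q * (p + (1 - p) * h ^ 2)) {x : TreeVertex d}
    (hx : ¬ x <:+ w) : potential r h w x ≤ stepMean q p (potential r h w) x := by
  cases x with
  | nil => exact absurd List.nil_suffix hx
  | cons i x =>
    have hd : (d : ℝ) ≠ 0 := Nat.cast_ne_zero.2 i.pos.ne'
    have child (j : Fin d) : potential r h w (j :: i :: x) = h ^ 2 * potential r h w x := by
      rw [potential_cons_of_not_suffix fun H => hx ((List.suffix_cons _ _).trans H),
        potential_cons_of_not_suffix hx]
      ring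
    calc potential r h w (i :: x) = h * potential r h w x := potential_cons_of_not_suffix hx
      _ ≤ q * (p + (1 - p) * h ^ 2) * potential r h w x :=
          mul_le_mul_of_nonneg_right hup (potential_mem_Icc hr hh x).1
      _ = stepMean q p (potential r h w) (i :: x) := by
          simp only [stepMean, child, List.tail_cons, Finset.sum_const, Finset.card_univ,
            Fintype.card_fin, nsmul_eq_mul]
          field_simp

theorem sum_potential_children {i : Fin d} {x : TreeVertex d} (hi : (i :: x) <:+ w) :
    ∑ j : Fin d, potential r h w (j :: x) =
      r ^ (w.length - (x.length + 1)) * (1 + (d - 1) * (h * r)) := by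
  have hlen : x.length + 1 ≤ w.length := hi.length_le
  have hx : potential r h w x = r ^ (w.length - (x.length + 1)) * r := by
    rw [potential_of_suffix ((List.suffix_cons i x).trans hi), ← pow_succ]
    congr 1
    lia
  have sibling (j : Fin d) (hj : j ≠ i) : potential r h w (j :: x) = h * potential r h w x :=
    potential_cons_of_not_suffix fun hj' =>
      Set.disjoint_left.1
        (TreeVertex.disjoint_subtree (x := j :: x) (y := i :: x) rfl (by simpa using hj)) hj' hi
  rw [← Finset.add_sum_erase _ _ (Finset.mem_univ i), potential_of_suffix hi,
    Finset.sum_congr rfl fun j hj => sibling j (Finset.ne_of_mem_erase hj), Finset.sum_const,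
    Finset.card_erase_of_mem (Finset.mem_univ i), Finset.card_univ, Fintype.card_fin,
    nsmul_eq_mul, Nat.cast_sub i.pos, Nat.cast_one, hx, List.length_cons]
  ring

theorem potential_le_stepMean_of_child_suffix {p q : ℝ} (hr : r ∈ Set.Icc (0 : ℝ) 1)
    (hp : 0 ≤ p) (hq : 0 ≤ q)
    (hdown : r ≤ q * (p * r ^ 2 + (1 - p) / d * (1 + (d - 1) * (h * r))))
    {i : Fin d} {x : TreeVertex d} (hi : (i :: x) <:+ w) :
    potential r h w x ≤ stepMean q p (potential r h w) x := by
  have hx : x <:+ w := (List.suffix_cons i x).trans hi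
  have hlen : x.length + 1 ≤ w.length := hi.length_le
  set m := w.length - (x.length + 1)
  have parent : r ^ m * r ^ 2 ≤ potential r h w x.tail := by
    rw [potential_of_suffix ((List.tail_suffix x).trans hx), ← pow_add]
    refine pow_le_pow_of_le_one hr.1 hr.2 ?_
    rw [List.length_tail]
    lia
  calc potential r h w x = r ^ m * r := by
        rw [potential_of_suffix hx, ← pow_succ]
        congr 1
        lia
    _ ≤ r ^ m * (q * (p * r ^ 2 + (1 - p) / d * (1 + (d - 1) * (h * r)))) :=
        mul_le_mul_of_nonneg_left hdown (pow_nonneg hr.1 m)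
    _ = q * (p * (r ^ m * r ^ 2) + (1 - p) / d * (r ^ m * (1 + (d - 1) * (h * r)))) := by ring
    _ ≤ q * (p * potential r h w x.tail + (1 - p) / d * (r ^ m * (1 + (d - 1) * (h * r)))) := by
        gcongr
    _ = stepMean q p (potential r h w) x := by rw [stepMean, sum_potential_children hi]

theorem potential_le_stepMean {p q : ℝ} (hr : r ∈ Set.Icc (0 : ℝ) 1) (hh : h ∈ Set.Icc (0 : ℝ) 1)
    (hp : 0 ≤ p) (hq : 0 ≤ q) (hup : h ≤ q * (p + (1 - p) * h ^ 2))
    (hdown : r ≤ q * (p * r ^ 2 + (1 - p) / d * (1 + (d - 1) * (h * r))))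
    {x : TreeVertex d} (hx : x ≠ w) :
    potential r h w x ≤ stepMean q p (potential r h w) x := by
  by_cases hxw : x <:+ w
  · obtain ⟨i, hi⟩ := TreeVertex.exists_child_suffix hxw hx
    exact potential_le_stepMean_of_child_suffix hr hp hq hdown hi
  · exact potential_le_stepMean_of_not_suffix hr hh hup hxw

end

end Potential

section Randomness

variable {d : ℕ} {q p : ℝ}

instance FrogStep.instDiscreteMeasurableSpace : DiscreteMeasurableSpace (FrogStep d) :=
  ⟨fun _ => trivial⟩

theorem frogStepLaw_real_toward (h : 0 ≤ q * p) :
    (frogStepLaw d q p).real {FrogStep.toward} = q * p := by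
  simp [frogStepLaw, Measure.real, Set.indicator, h]

theorem frogStepLaw_real_away (h : 0 ≤ q * ((1 - p) / d)) (i : Fin d) :
    (frogStepLaw d q p).real {FrogStep.away i} = q * ((1 - p) / d) := by
  simp [frogStepLaw, Measure.real, Set.indicator, h]

instance isProbabilityMeasure_frogMeasure [IsProbabilityMeasure (frogStepLaw d q p)] :
    IsProbabilityMeasure (frogMeasure d q p) := by
  unfold frogMeasure
  infer_instance

/-- The σ-algebra generated by the instructions of the frogs which start in `V`. -/
abbrev frogSigma (V : Set (TreeVertex d)) : MeasurableSpace (FrogInstructions d) :=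
  cylinderEvents (Prod.fst ⁻¹' V)

theorem frogSigma_mono {V W : Set (TreeVertex d)} (h : V ⊆ W) : frogSigma V ≤ frogSigma W :=
  cylinderEvents_mono (Set.preimage_mono h)

theorem frogMeasure_real_inter_of_disjoint [IsProbabilityMeasure (frogStepLaw d q p)]
    {V W : Set (TreeVertex d)} (hVW : Disjoint V W) {A B : Set (FrogInstructions d)}
    (hA : MeasurableSet[frogSigma V] A) (hB : MeasurableSet[frogSigma W] B) :
    (frogMeasure d q p).real (A ∩ B) = (frogMeasure d q p).real A * (frogMeasure d q p).real B :=
  measureReal_infinitePi_inter_of_disjoint (hVW.preimage _) hA hB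

end Randomness

namespace FrogInstructions

variable {d : ℕ} {v w x : TreeVertex d} {n k : ℕ}

section Measurability

/-- The frog `v`, put in the state `s`, visits `w` within its next `n` steps. -/
def VisitsWithin (ω : FrogInstructions d) (v w : TreeVertex d) (n : ℕ) (s : FrogState d) : Prop :=
  ∃ m ≤ n, ((FrogState.move ω v)^[m] s).IsActiveAt w

theorem visitsWithin_of_isActiveAt {ω : FrogInstructions d} {s : FrogState d}
    (hs : s.IsActiveAt w) : ω.VisitsWithin v w n s :=
  ⟨0, n.zero_le, hs⟩

theorem visitsWithin_zero {ω : FrogInstructions d} {s : FrogState d} :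
    ω.VisitsWithin v w 0 s ↔ s.IsActiveAt w := by
  simp [VisitsWithin]

theorem visitsWithin_succ {ω : FrogInstructions d} {s : FrogState d} (hs : ¬ s.IsActiveAt w) :
    ω.VisitsWithin v w (n + 1) s ↔ ω.VisitsWithin v w n (s.move ω v) := by
  constructor
  · rintro ⟨_ | m, hm, h⟩
    · exact absurd h hs
    · exact ⟨m, Nat.le_of_succ_le_succ hm, h⟩
  · rintro ⟨m, hm, h⟩
    exact ⟨m + 1, Nat.succ_le_succ hm, h⟩

theorem not_visitsWithin_dead {ω : FrogInstructions d} :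
    ¬ ω.VisitsWithin v w n FrogState.dead := by
  rintro ⟨m, -, k, hk⟩
  rw [Function.iterate_fixed rfl] at hk
  cases hk

/- Here and below `none` stands for the step towards the root and `some i` for the step to the
`i`-th child. -/
theorem setOf_visitsWithin_succ (hx : x ≠ w) :
    {ω | VisitsWithin ω v w (n + 1) (.active x k)} = ⋃ o : Option (Fin d),
      {ω | ω (v, k) = o.elim .toward .away} ∩
        {ω | VisitsWithin ω v w n (.active (o.elim x.tail (· :: x)) (k + 1))} := by
  ext ω
  have hs : ¬ (FrogState.active x k).IsActiveAt w := by rwa [FrogState.isActiveAt_active_iff]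
  cases hω : ω (v, k) <;>
    simp [visitsWithin_succ hs, FrogState.move, hω, not_visitsWithin_dead, Option.exists]

theorem measurableSet_visitsWithin (v w : TreeVertex d) (n k : ℕ) (x : TreeVertex d) :
    MeasurableSet[cylinderEvents {a : TreeVertex d × ℕ | a.1 = v ∧ k ≤ a.2}]
      {ω : FrogInstructions d | ω.VisitsWithin v w n (.active x k)} := by
  induction n generalizing k x with
  | zero =>
    simp only [visitsWithin_zero]
    exact MeasurableSet.const _
  | succ n ih =>
    by_cases hx : x = w
    · simp only [visitsWithin_of_isActiveAt (FrogState.isActiveAt_active_iff.2 hx)]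
      exact MeasurableSet.const _
    · rw [setOf_visitsWithin_succ hx]
      have later_subset : {a : TreeVertex d × ℕ | a.1 = v ∧ k + 1 ≤ a.2} ⊆
          {a | a.1 = v ∧ k ≤ a.2} := fun a ha => ⟨ha.1, Nat.le_of_succ_le ha.2⟩
      exact .iUnion fun o => .inter (measurableSet_cylinderEvents_eval_eq (by simp) _)
        (cylinderEvents_mono later_subset _ (ih (k + 1) _))

theorem setOf_hits (v w : TreeVertex d) : {ω : FrogInstructions d | ω.Hits v w} =
    ⋃ n, {ω | ω.VisitsWithin v w n (.active v 0)} := by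
  ext ω
  simp only [Set.mem_ofPred_eq, Set.mem_iUnion]
  exact ⟨fun ⟨n, hn⟩ => ⟨n, n, le_rfl, hn⟩, fun ⟨_, m, _, hm⟩ => ⟨m, hm⟩⟩

theorem measurableSet_hits {V : Set (TreeVertex d)} (hv : v ∈ V) (w : TreeVertex d) :
    MeasurableSet[frogSigma V] {ω | ω.Hits v w} := by
  rw [setOf_hits]
  refine .iUnion fun n => cylinderEvents_mono ?_ _ (measurableSet_visitsWithin v w n 0 v)
  rintro ⟨_, k⟩ ⟨rfl, -⟩
  exact hv

theorem measurableSet_relays (x : TreeVertex d) (i j : Fin d) :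
    MeasurableSet[frogSigma {x, i :: x}] {ω | ω.Relays x i j} :=
  (measurableSet_hits (by simp) _).union
    ((measurableSet_hits (by simp) _).inter (measurableSet_hits (by simp) _))

theorem setOf_relaysBack_succ (n : ℕ) (x : TreeVertex d) :
    {ω : FrogInstructions d | ω.RelaysBack (n + 1) x} = ⋃ ij : Fin d × Fin d,
      {ω | ω.Relays x ij.1 ij.2} ∩ {ω | ω.RelaysBack n (ij.2 :: ij.1 :: x)} := by
  ext ω
  simp [RelaysBack]

theorem measurableSet_relaysBack (n : ℕ) (x : TreeVertex d) :
    MeasurableSet[frogSigma x.subtree] {ω | ω.RelaysBack n x} := by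
  induction n generalizing x with
  | zero => exact measurableSet_hits (List.suffix_refl x) _
  | succ n ih =>
    rw [setOf_relaysBack_succ]
    refine .iUnion fun ij => .inter ?_ ?_
    · refine frogSigma_mono ?_ _ (measurableSet_relays x ij.1 ij.2)
      rintro v (rfl | rfl)
      · exact List.suffix_refl _
      · exact List.suffix_cons _ _
    · exact frogSigma_mono (TreeVertex.cons_cons_subset_subtree x _ _) _ (ih _)

end Measurability

section Probability

variable {q p : ℝ} [IsProbabilityMeasure (frogStepLaw d q p)]

theorem measureReal_visitsWithin_succ (hq : 0 ≤ q) (hp : p ∈ Set.Icc (0 : ℝ) 1) (hx : x ≠ w)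
    (v : TreeVertex d) (n k : ℕ) :
    (frogMeasure d q p).real {ω | ω.VisitsWithin v w (n + 1) (.active x k)} =
      stepMean q p (fun y =>
        (frogMeasure d q p).real {ω | ω.VisitsWithin v w n (.active y (k + 1))}) x := by
  have hp₀ := hp.1
  have hp₁ := sub_nonneg.2 hp.2
  have step_injective :
      Function.Injective fun o : Option (Fin d) => o.elim FrogStep.toward FrogStep.away := by
    rintro (_ | i) (_ | j) h <;> simp_all
  have notMem : (v, k) ∉ {a : TreeVertex d × ℕ | a.1 = v ∧ k + 1 ≤ a.2} := by simp
  rw [setOf_visitsWithin_succ hx, frogMeasure,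
    measureReal_infinitePi_iUnion_eval_eq_inter notMem step_injective
      fun _ => measurableSet_visitsWithin v w n (k + 1) _,
    Fintype.sum_option]
  simp only [Option.elim_none, Option.elim_some]
  rw [frogStepLaw_real_toward (by positivity),
    Finset.sum_congr rfl fun i _ => by rw [frogStepLaw_real_away (by positivity)],
    ← Finset.mul_sum, stepMean]
  ring

/- The walk killed at rate `1 - q₀` has died by time `n` with probability `1 - q₀ ^ n`;
until then `φ` at its position is a submartingale. -/
theorem sub_pow_le_measureReal_visitsWithin (hd : d ≠ 0) {q₀ : ℝ} (hq₀ : 0 ≤ q₀) (hq : q₀ ≤ q)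
    (hp : p ∈ Set.Icc (0 : ℝ) 1) {φ : TreeVertex d → ℝ} (hφ₁ : ∀ x, φ x ≤ 1)
    (hφ : ∀ x ≠ w, φ x ≤ stepMean q₀ p φ x) (v : TreeVertex d) (n k : ℕ) (x : TreeVertex d) :
    φ x - q₀ ^ n ≤ (frogMeasure d q p).real {ω | ω.VisitsWithin v w n (.active x k)} := by
  induction n generalizing k x with
  | zero =>
    rw [pow_zero]
    exact (sub_nonpos.2 (hφ₁ x)).trans measureReal_nonneg
  | succ n ih =>
    by_cases hx : x = w
    · simp only [visitsWithin_of_isActiveAt (FrogState.isActiveAt_active_iff.2 hx),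
        Set.ofPred_true, probReal_univ]
      linarith [hφ₁ x, pow_nonneg hq₀ (n + 1)]
    · calc φ x - q₀ ^ (n + 1) ≤ stepMean q₀ p φ x - q₀ ^ (n + 1) := sub_le_sub_right (hφ x hx) _
        _ = stepMean q₀ p (fun y => φ y - q₀ ^ n) x := by rw [stepMean_sub_const hd, pow_succ']
        _ ≤ stepMean q p (fun y =>
              (frogMeasure d q p).real {ω | ω.VisitsWithin v w n (.active y (k + 1))}) x :=
            stepMean_mono hq₀ hq hp (fun _ => measureReal_nonneg) (ih (k + 1)) x
        _ = (frogMeasure d q p).real {ω | ω.VisitsWithin v w (n + 1) (.active x k)} :=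
            (measureReal_visitsWithin_succ (hq₀.trans hq) hp hx v n k).symm

theorem le_measureReal_hits (hd : d ≠ 0) {q₀ : ℝ} (hq₀ : q₀ ∈ Set.Ico (0 : ℝ) 1) (hq : q₀ ≤ q)
    (hp : p ∈ Set.Icc (0 : ℝ) 1) {φ : TreeVertex d → ℝ} (hφ₁ : ∀ x, φ x ≤ 1)
    (hφ : ∀ x ≠ w, φ x ≤ stepMean q₀ p φ x) (v : TreeVertex d) :
    φ v ≤ (frogMeasure d q p).real {ω | ω.Hits v w} := by
  have hlim : Filter.Tendsto (fun n : ℕ => φ v - q₀ ^ n) Filter.atTop (nhds (φ v)) := by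
    simpa using (tendsto_pow_atTop_nhds_zero_of_lt_one hq₀.1 hq₀.2).const_sub (φ v)
  refine le_of_tendsto' hlim fun n => ?_
  refine (sub_pow_le_measureReal_visitsWithin hd hq₀.1 hq hp hφ₁ hφ v n 0 v).trans
    (measureReal_mono ?_)
  rw [setOf_hits]
  exact Set.subset_iUnion_of_subset n subset_rfl

theorem le_measureReal_relays {r : ℝ} (hr : r ∈ Set.Icc (0 : ℝ) 1)
    (hchild : ∀ (x : TreeVertex d) i, r ≤ (frogMeasure d q p).real {ω | ω.Hits x (i :: x)})
    (hgrandchild : ∀ (x : TreeVertex d) i j,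
      r ^ 2 ≤ (frogMeasure d q p).real {ω | ω.Hits x (j :: i :: x)})
    (x : TreeVertex d) (i j : Fin d) :
    2 * r ^ 2 - r ^ 3 ≤ (frogMeasure d q p).real {ω | ω.Relays x i j} := by
  set μ := frogMeasure d q p
  set C : Set (FrogInstructions d) := {ω | ω.Hits x (i :: x)}
  set G : Set (FrogInstructions d) := {ω | ω.Hits x (j :: i :: x)}
  set W : Set (FrogInstructions d) := {ω | ω.Hits (i :: x) (j :: i :: x)}
  have hC : MeasurableSet[frogSigma {x}] C := measurableSet_hits (Set.mem_singleton x) _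
  have hG : MeasurableSet[frogSigma {x}] G := measurableSet_hits (Set.mem_singleton x) _
  have hW : MeasurableSet[frogSigma {i :: x}] W := measurableSet_hits (Set.mem_singleton _) _
  have relays_eq : {ω | ω.Relays x i j} = G ∪ (C \ G) ∩ W := by
    ext ω
    simp only [C, G, W, Relays, Set.mem_ofPred_eq, Set.mem_union, Set.mem_inter_iff, Set.mem_sdiff]
    tauto
  have hCG : μ.real C - μ.real G ≤ μ.real (C \ G) := le_measureReal_sdiff
  have hW₁ : 0 ≤ 1 - μ.real W := sub_nonneg.2 measureReal_le_one
  calc 2 * r ^ 2 - r ^ 3 ≤ r ^ 2 + (r - r ^ 2) * r := by linarith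
    _ ≤ r ^ 2 + (r - r ^ 2) * μ.real W := by
        have := sub_nonneg.2 (pow_le_of_le_one hr.1 hr.2 two_ne_zero)
        gcongr
        exact hchild (i :: x) j
    _ = r ^ 2 * (1 - μ.real W) + r * μ.real W := by ring
    _ ≤ μ.real G * (1 - μ.real W) + μ.real C * μ.real W := by
        gcongr
        · exact hgrandchild x i j
        · exact hchild x i
    _ = μ.real G + (μ.real C - μ.real G) * μ.real W := by ring
    _ ≤ μ.real G + μ.real (C \ G) * μ.real W := by gcongr
    _ = μ.real (G ∪ (C \ G) ∩ W) := by
        rw [measureReal_union (Set.disjoint_sdiff_right.mono_right Set.inter_subset_left)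
          (((cylinderEvents_le_pi _ hC).diff (cylinderEvents_le_pi _ hG)).inter
            (cylinderEvents_le_pi _ hW)),
          frogMeasure_real_inter_of_disjoint (by simp) (hC.diff hG) hW]
    _ = μ.real {ω | ω.Relays x i j} := by rw [relays_eq]

theorem mul_sub_sq_le_measureReal_relaysBack_succ {e σ : ℝ}
    (he : ∀ (x : TreeVertex d) i j, e ≤ (frogMeasure d q p).real {ω | ω.Relays x i j})
    (hσ₀ : 0 ≤ σ) (hσ : σ ≤ ∑ ij : Fin d × Fin d,
      (frogMeasure d q p).real {ω | ω.RelaysBack n (ij.2 :: ij.1 :: x)}) :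
    e * σ - σ ^ 2 ≤ (frogMeasure d q p).real {ω | ω.RelaysBack (n + 1) x} := by
  rw [setOf_relaysBack_succ]
  refine mul_sub_sq_le_measureReal_iUnion_inter
    (fun ij => cylinderEvents_le_pi _ (measurableSet_relays x ij.1 ij.2))
    (fun ij => cylinderEvents_le_pi _ (measurableSet_relaysBack n _))
    (fun ij => frogMeasure_real_inter_of_disjoint ?_ (measurableSet_relays x ij.1 ij.2)
      (measurableSet_relaysBack n _))
    (fun ij ij' hne => frogMeasure_real_inter_of_disjoint
      (TreeVertex.disjoint_subtree (by simp) ?_) (measurableSet_relaysBack n _)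
      (measurableSet_relaysBack n _))
    (fun ij => he x ij.1 ij.2) hσ₀ hσ
  · refine Set.disjoint_left.2 fun v hv hv' => ?_
    have hlen := List.IsSuffix.length_le hv'
    rcases hv with rfl | rfl <;> simp at hlen
  · intro heq
    simp only [List.cons.injEq, and_true] at heq
    exact hne (Prod.ext heq.2 heq.1)

theorem le_measureReal_relaysBack {e h s : ℝ} (hh : h ∈ Set.Icc (0 : ℝ) 1)
    (hs : s ∈ Set.Icc (0 : ℝ) 1)
    (hroot : ∀ x : TreeVertex d, h ^ x.length ≤ (frogMeasure d q p).real {ω | ω.Hits x []})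
    (he : ∀ (x : TreeVertex d) i j, e ≤ (frogMeasure d q p).real {ω | ω.Relays x i j})
    (hgrow : 1 ≤ (d * h) ^ 2 * (e - d ^ 2 * s)) (n : ℕ) (x : TreeVertex d) :
    s * h ^ x.length ≤ (frogMeasure d q p).real {ω | ω.RelaysBack n x} := by
  have hh₀ := hh.1
  have hs₀ := hs.1
  induction n generalizing x with
  | zero => exact (mul_le_of_le_one_left (by positivity) hs.2).trans (hroot x)
  | succ n ih =>
    set σ : ℝ := d ^ 2 * (s * h ^ (x.length + 2)) with hσ
    have hσ_le : σ ≤ d ^ 2 * s :=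
      mul_le_mul_of_nonneg_left (mul_le_of_le_one_right hs₀ (pow_le_one₀ hh₀ hh.2)) (by positivity)
    have hσ_sum : σ ≤ ∑ ij : Fin d × Fin d,
        (frogMeasure d q p).real {ω | ω.RelaysBack n (ij.2 :: ij.1 :: x)} := by
      calc σ = ∑ _ij : Fin d × Fin d, s * h ^ (x.length + 2) := by
            simp [hσ, sq]
        _ ≤ _ := Finset.sum_le_sum fun ij _ => ih (ij.2 :: ij.1 :: x)
    calc s * h ^ x.length ≤ s * h ^ x.length * ((d * h) ^ 2 * (e - d ^ 2 * s)) :=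
          le_mul_of_one_le_right (by positivity) hgrow
      _ = σ * (e - d ^ 2 * s) := by rw [hσ]; ring
      _ ≤ σ * (e - σ) := by gcongr
      _ = e * σ - σ ^ 2 := by ring
      _ ≤ (frogMeasure d q p).real {ω | ω.RelaysBack (n + 1) x} :=
          mul_sub_sq_le_measureReal_relaysBack_succ he (by positivity) hσ_sum

theorem frogMeasure_frogRecurrent_pos_of_le_relaysBack {c : ℝ} (hc : 0 < c)
    (hback : ∀ n, c ≤ (frogMeasure d q p).real {ω | ω.RelaysBack n []}) :
    0 < frogMeasure d q p {ω | FrogRecurrent ω} :=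
  calc 0 < ENNReal.ofReal c := ENNReal.ofReal_pos.2 hc
    _ ≤ frogMeasure d q p {ω | ∃ᶠ n in Filter.atTop, ω.RelaysBack n []} :=
        le_measure_frequently
          (fun n => cylinderEvents_le_pi _ (measurableSet_relaysBack n []))
          fun n => ENNReal.ofReal_le_of_le_toReal (hback n)
    _ ≤ frogMeasure d q p {ω | FrogRecurrent ω} :=
        measure_mono fun _ => frogRecurrent_of_frequently_relaysBack

theorem frogMeasure_frogRecurrent_pos_of_le_relays {e h : ℝ} (hh : h ∈ Set.Icc (0 : ℝ) 1)
    (hroot : ∀ x : TreeVertex d, h ^ x.length ≤ (frogMeasure d q p).real {ω | ω.Hits x []})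
    (he : ∀ (x : TreeVertex d) i j, e ≤ (frogMeasure d q p).real {ω | ω.Relays x i j})
    (hgrow : 1 < (d * h) ^ 2 * e) : 0 < frogMeasure d q p {ω | FrogRecurrent ω} := by
  have growth_at_small_scale : Filter.Tendsto (fun s : ℝ => (d * h) ^ 2 * (e - d ^ 2 * s))
      (nhdsWithin 0 (Set.Ioi 0)) (nhds ((d * h) ^ 2 * e)) :=
    (Continuous.tendsto' (by fun_prop) _ _ (by simp)).mono_left nhdsWithin_le_nhds
  obtain ⟨s, hs, hs₀, hs₁⟩ := ((growth_at_small_scale.eventually_const_lt hgrow).and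
    (Ioc_mem_nhdsGT zero_lt_one)).exists
  refine frogMeasure_frogRecurrent_pos_of_le_relaysBack hs₀ fun n => ?_
  simpa using le_measureReal_relaysBack hh ⟨hs₀.le, hs₁⟩ hroot he hs.le n []

end Probability

end FrogInstructions

theorem frogMeasure_frogRecurrent_pos_of_growth {d : ℕ} {q₀ q p r h : ℝ}
    (hq₀ : q₀ ∈ Set.Ico (0 : ℝ) 1) (hq : q ∈ Set.Icc q₀ 1) (hp : p ∈ Set.Icc (0 : ℝ) 1)
    (hr : r ∈ Set.Icc (0 : ℝ) 1) (hh : h ∈ Set.Icc (0 : ℝ) 1) (hup : h ≤ q₀ * (p + (1 - p) * h ^ 2))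
    (hdown : r ≤ q₀ * (p * r ^ 2 + (1 - p) / d * (1 + (d - 1) * (h * r))))
    (hgrow : 1 < (d * h) ^ 2 * (2 * r ^ 2 - r ^ 3)) :
    0 < frogMeasure d q p {ω | FrogRecurrent ω} := by
  have hd : d ≠ 0 := by
    rintro rfl
    norm_num at hgrow
  have := isProbabilityMeasure_frogStepLaw hd ⟨hq₀.1.trans hq.1, hq.2⟩ hp
  have hits (x w : TreeVertex d) :
      potential r h w x ≤ (frogMeasure d q p).real {ω | ω.Hits x w} :=
    FrogInstructions.le_measureReal_hits hd hq₀ hq.1 hp (fun y => (potential_mem_Icc hr hh y).2)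
      (fun y hy => potential_le_stepMean hr hh hp.1 hq₀.1 hup hdown hy) x
  have relays := FrogInstructions.le_measureReal_relays hr
    (fun x i => (potential_child i x).symm.trans_le (hits x (i :: x)))
    (fun x i j => (potential_grandchild i j x).symm.trans_le (hits x (j :: i :: x)))
  exact FrogInstructions.frogMeasure_frogRecurrent_pos_of_le_relays hh
    (fun x => (potential_root x).symm.trans_le (hits x [])) relays hgrow

theorem child_step_bound {d p : ℝ} (hd : 1 ≤ d) (hp : p ≤ 0.5) :
    0.9 / d ≤ 0.999 * (p * (0.9 / d) ^ 2 + (1 - p) / d * (1 + (d - 1) * (0.9 * (0.9 / d)))) := by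
  have hmono : 0 ≤ (0.5 - p) * (d - 1) := mul_nonneg (by linarith) (by linarith)
  calc 0.9 / d = 0.9 * d / d ^ 2 := by field_simp
    _ ≤ 0.999 * (p * 0.81 + (1 - p) * (d + (d - 1) * 0.81)) / d ^ 2 :=
        div_le_div_of_nonneg_right (by linarith) (by positivity)
    _ = 0.999 * (p * (0.9 / d) ^ 2 + (1 - p) / d * (1 + (d - 1) * (0.9 * (0.9 / d)))) := by
        field_simp
        ring

theorem theorem1p1_general (d : ℕ) (hd : 2 ≤ d) (p q : ℝ) (hp : p ∈ Set.Icc (0.48 : ℝ) 0.5)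
    (hq : q ∈ Set.Icc (0.999 : ℝ) 1) :
    0 < frogMeasure d q p {ω : FrogInstructions d | FrogRecurrent ω} := by
  have hd₂ : (2 : ℝ) ≤ d := by exact_mod_cast hd
  have hd₀ : (0 : ℝ) < d := by linarith
  obtain ⟨hp₀, hp₁⟩ := hp
  set r : ℝ := 0.9 / d with hr
  have hrd : d * r = 0.9 := mul_div_cancel₀ _ hd₀.ne'
  have hr₀ : 0 ≤ r := by positivity
  have hr₁ : r ≤ 0.45 := by rw [hr, div_le_iff₀ hd₀]; linarith
  refine frogMeasure_frogRecurrent_pos_of_growth (q₀ := 0.999) (r := r) (h := 0.9) (by norm_num) hq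
    ⟨by linarith, by linarith⟩ ⟨hr₀, by linarith⟩ (by norm_num) (by linarith)
    (child_step_bound (by linarith) hp₁) ?_
  calc (1 : ℝ) < 0.9 ^ 2 * 0.9 ^ 2 * (2 - r) := by linarith
    _ = (d * r) ^ 2 * 0.9 ^ 2 * (2 - r) := by rw [hrd]
    _ = (d * 0.9) ^ 2 * (2 * r ^ 2 - r ^ 3) := by ring

theorem theorem1p1 (d : ℕ) (hd : 2 ≤ d) (p q : ℝ)
    (hp : p ∈ Set.Icc (0.4950 : ℝ) 0.4975) (hq : q ∈ Set.Icc (0.9999998 : ℝ) 1) :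
    0 < frogMeasure d q p {ω : FrogInstructions d | FrogRecurrent ω} :=
  theorem1p1_general d hd p q ⟨by linarith [hp.1], by linarith [hp.2]⟩ ⟨by linarith [hq.1], hq.2⟩
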